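/- Let $d=(d_n)_{n\ge 0}$ with $d_n=\log(n+3)$ (so $1\le d_n\uparrow\infty$), and let $h_d$ be the normed space of all complex sequences $x=(x_n)_{n\ge 0}$ with $x_n\to 0$ and $\|x\|_{h_d}:=\sum_{k=0}^\infty d_k|x_{k+1}-x_k|<\infty$. For a bounded linear operator $T$ on a complex normed space $X$ let $T'\colon X'\to X'$, $T'u=u\circ T$, be its dual operator on the dual space $X'$; let $\sigma(T;X)$ be the set of all $z\in\mathbb C$ such that $zI-T$ has no bounded inverse on $X$, $\sigma_{pt}(T;X)$ the set of all $z\in\mathbb C$ such that $zI-T$ is not injective, and $\sigma_r(T;X)$ the set of all $z\in\mathbb C$ such that $zI-T$ is injective and its range is not dense in $X$. The operator $T$ is mean ergodic if the averages $\frac1n\sum_{m=1}^nT^m$ converge in the strong operator topology to a bounded operator as $n\to\infty$; it is supercyclic if the set $\{cT^nx : c\in\mathbb C,\ n\ge 0\}$ is dense in $X$ for some $x\in X$. (i) The Cesàro operator $C_1x:=\bigl(\frac{x_0+x_1+\cdots+x_n}{n+1}\bigr)_{n\ge 0}$ maps $h_d$ into $h_d$ and is bounded there. (ii) $\sigma_{pt}(C_1;h_d)=\emptyset$.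 (iii) $\{z\in\mathbb C : |z-\frac12|<\frac12\}\cup\{1\}\subseteq\sigma_{pt}(C_1';h_d')\subseteq\sigma_r(C_1;h_d)$. In particular, $\{z\in\mathbb C : |z-\frac12|\le\frac12\}\subseteq\sigma(C_1;h_d)$. (iv) The operator $C_1$ on $h_d$ is not compact, not mean ergodic and not supercyclic. -/

import Mathlib

open Filter Topology

noncomputable section

/-- A weight sequence `1 ≤ d₀ ≤ d₁ ≤ …` with `dₙ → ∞`. -/
structure HahnWeight where
  /-- the underlying real sequence -/
  d : ℕ → ℝ
  one_le : ∀ n, 1 ≤ d n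
  mono : Monotone d
  tendsto : Tendsto d atTop atTop

/-- The weight `dₙ = log (n + 3)`. -/
def logWeight : HahnWeight where
  d := fun n => Real.log ((n : ℝ) + 3)
  one_le := by
    intro n
    rw [Real.le_log_iff_exp_le (by positivity)]
    have h1 := Real.exp_one_lt_d9
    have h2 : (0 : ℝ) ≤ n := Nat.cast_nonneg n
    linarith
  mono := by
    intro m n hmn
    have h : (m : ℝ) ≤ n := by exact_mod_cast hmn
    exact Real.log_le_log (by positivity) (by linarith)
  tendsto :=
    Real.tendsto_log_atTop.comp
      (tendsto_atTop_add_const_right _ _ tendsto_natCast_atTop_atTop)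

/-- The linear subspace of `ℂ^ℕ` of all null sequences `x` with
`∑ dₖ |xₖ₊₁ - xₖ| < ∞`. -/
def hahnSubmodule (w : HahnWeight) : Submodule ℂ (ℕ → ℂ) where
  carrier := {x | Tendsto x atTop (𝓝 0) ∧
    Summable fun k : ℕ => w.d k * ‖x (k + 1) - x k‖}
  zero_mem' := by
    refine ⟨tendsto_const_nhds, ?_⟩
    simp
  add_mem' := by
    rintro x y ⟨hx, hx'⟩ ⟨hy, hy'⟩
    refine ⟨(add_zero (0 : ℂ)) ▸ hx.add hy, ?_⟩
    refine Summable.of_nonneg_of_le (fun k => ?_) (fun k => ?_) (hx'.add hy')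
    · exact mul_nonneg (zero_le_one.trans (w.one_le k)) (norm_nonneg _)
    · rw [← mul_add]
      refine mul_le_mul_of_nonneg_left ?_ (zero_le_one.trans (w.one_le k))
      have : (x + y) (k + 1) - (x + y) k = (x (k + 1) - x k) + (y (k + 1) - y k) := by
        simp only [Pi.add_apply]; ring
      rw [this]
      exact norm_add_le _ _
  smul_mem' := by
    rintro c x ⟨hx, hx'⟩
    refine ⟨(smul_zero c : c • (0 : ℂ) = 0) ▸ hx.const_smul c, ?_⟩
    refine (hx'.mul_left ‖c‖).congr (fun k => ?_)
    simp only [Pi.smul_apply, smul_eq_mul, ← mul_sub, norm_mul]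
    ring

/-- The generalized Hahn space `h_d` as a type of its own, so that it carries the topology of the
norm below and not the one of coordinatewise convergence. -/
def HahnSpace (w : HahnWeight) : Type := hahnSubmodule w

namespace HahnSpace

variable {w : HahnWeight}

instance : AddCommGroup (HahnSpace w) := inferInstanceAs (AddCommGroup (hahnSubmodule w))

instance : Module ℂ (HahnSpace w) := inferInstanceAs (Module ℂ (hahnSubmodule w))

/-- The sequence underlying an element of `h_d`. -/
def seq (x : HahnSpace w) : ℕ → ℂ := Subtype.val x

/-- The element of `h_d` given by a sequence in the subspace. -/
def mk (x : ℕ → ℂ) (hx : x ∈ hahnSubmodule w) : HahnSpace w := Subtype.mk x hx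

@[simp] theorem seq_mk (x : ℕ → ℂ) (hx : x ∈ hahnSubmodule w) : (mk x hx).seq = x := rfl

theorem seq_mem (x : HahnSpace w) : x.seq ∈ hahnSubmodule w := Subtype.property x

/-- The norm `‖x‖ = ∑ dₖ |xₖ₊₁ - xₖ|`. -/
instance : Norm (HahnSpace w) := ⟨fun x => ∑' k : ℕ, w.d k * ‖x.seq (k + 1) - x.seq k‖⟩

theorem norm_def (x : HahnSpace w) :
    ‖x‖ = ∑' k : ℕ, w.d k * ‖x.seq (k + 1) - x.seq k‖ := rfl

@[simp] theorem seq_zero : (0 : HahnSpace w).seq = 0 := rfl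

@[simp] theorem seq_add (x y : HahnSpace w) : (x + y).seq = x.seq + y.seq := rfl

@[simp] theorem seq_sub (x y : HahnSpace w) : (x - y).seq = x.seq - y.seq := rfl

@[simp] theorem seq_smul (c : ℂ) (x : HahnSpace w) : (c • x).seq = c • x.seq := rfl

theorem term_nonneg (x : HahnSpace w) (k : ℕ) : 0 ≤ w.d k * ‖x.seq (k + 1) - x.seq k‖ :=
  mul_nonneg (zero_le_one.trans (w.one_le k)) (norm_nonneg _)

theorem ext_seq {x y : HahnSpace w} (h : x.seq = y.seq) : x = y := Subtype.ext h

theorem normCore : NormedSpace.Core ℂ (HahnSpace w) where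
  norm_nonneg x := tsum_nonneg x.term_nonneg
  norm_smul c x := by
    rw [norm_def, norm_def, ← tsum_mul_left]
    refine tsum_congr (fun k => ?_)
    simp only [seq_smul, Pi.smul_apply, smul_eq_mul, ← mul_sub, norm_mul]
    ring
  norm_triangle x y := by
    have hx := x.seq_mem.2
    have hy := y.seq_mem.2
    rw [norm_def, norm_def, norm_def, ← hx.tsum_add hy]
    refine (x + y).seq_mem.2.tsum_le_tsum (fun k => ?_) (hx.add hy)
    rw [← mul_add]
    refine mul_le_mul_of_nonneg_left ?_ (zero_le_one.trans (w.one_le k))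
    have : (x + y).seq (k + 1) - (x + y).seq k
        = (x.seq (k + 1) - x.seq k) + (y.seq (k + 1) - y.seq k) := by
      simp only [seq_add, Pi.add_apply]; ring
    rw [this]
    exact norm_add_le _ _
  norm_eq_zero_iff x := by
    constructor
    · intro h
      have hk : ∀ k : ℕ, x.seq (k + 1) = x.seq k := by
        intro k
        have h0 := (hasSum_zero_iff_of_nonneg x.term_nonneg).1
          (h ▸ x.seq_mem.2.hasSum : HasSum _ (0 : ℝ))
        have h1 : w.d k * ‖x.seq (k + 1) - x.seq k‖ = 0 := congrFun h0 k
        have h2 : w.d k ≠ 0 := (zero_lt_one.trans_le (w.one_le k)).ne'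
        exact sub_eq_zero.1 (norm_eq_zero.1 ((mul_eq_zero.1 h1).resolve_left h2))
      have hc : ∀ k : ℕ, x.seq k = x.seq 0 := by
        intro k
        induction k with
        | zero => rfl
        | succ k ih => rw [hk k, ih]
      have h0 : x.seq 0 = 0 :=
        tendsto_nhds_unique (tendsto_const_nhds.congr fun k => (hc k).symm) x.seq_mem.1
      exact ext_seq (funext fun k => (hc k).trans h0)
    · rintro rfl
      simp [norm_def]

instance : NormedAddCommGroup (HahnSpace w) := NormedAddCommGroup.ofCore normCore

instance : NormedSpace ℂ (HahnSpace w) := NormedSpace.ofCore normCore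

end HahnSpace

/-- The classical Cesàro averaging of a complex sequence. -/
def cesaroMean (x : ℕ → ℂ) : ℕ → ℂ :=
  fun n => (∑ k ∈ Finset.range (n + 1), x k) / ((n : ℂ) + 1)

section Operators

variable {X : Type*} [NormedAddCommGroup X] [NormedSpace ℂ X]

/-- The dual operator `T' : X' → X'`, `u ↦ u ∘ T`. -/
def dualOperator (T : X →L[ℂ] X) : StrongDual ℂ X →L[ℂ] StrongDual ℂ X :=
  ContinuousLinearMap.precomp ℂ T

/-- The point spectrum: all `z` such that `z I - T` is not injective. -/
def pointSpectrum (T : X →L[ℂ] X) : Set ℂ :=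
  {z | ¬ Function.Injective (z • ContinuousLinearMap.id ℂ X - T)}

/-- The residual spectrum: all `z` such that `z I - T` is injective with non-dense range. -/
def residualSpectrum (T : X →L[ℂ] X) : Set ℂ :=
  {z | Function.Injective (z • ContinuousLinearMap.id ℂ X - T) ∧
    ¬ DenseRange (z • ContinuousLinearMap.id ℂ X - T)}

/-- `T` is mean ergodic if its Cesàro means `(1/n) (T + T² + … + Tⁿ)` converge to some bounded
operator in the strong operator topology. -/
def IsMeanErgodic (T : X →L[ℂ] X) : Prop :=
  ∃ P : X →L[ℂ] X, ∀ x : X,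
    Tendsto (fun n : ℕ => ((n : ℂ)⁻¹ • ∑ m ∈ Finset.Icc 1 n, T ^ m) x) atTop (𝓝 (P x))

/-- `T` is supercyclic if some projective orbit `{c Tⁿ x : c ∈ ℂ, n ≥ 0}` is dense. -/
def IsSupercyclic (T : X →L[ℂ] X) : Prop :=
  ∃ x : X, Dense {y : X | ∃ (c : ℂ) (n : ℕ), y = c • (T ^ n) x}

end Operators

end

/-! Boundedness is weighted Abel summation: a difference of consecutive means is a positive average
of the differences of `x`, and `logWeight_div_le` dominates its weights by a telescoping sequence.
Here alone the logarithm matters; it gives the bound 2. An eigenvector of averaging satisfies a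
recursion that keeps its moduli away from 0, so a null sequence cannot be one. The transposed matrix
has the eigenvector `cesaroDualSeq μ` for `1 / μ`; it is summable when `1 < μ.re`, that is, on the
open disc. An eigenfunctional kills the range of `z I - T`, whence the residual spectrum. The closed
disc follows because the spectrum of the dual operator is closed. Normalised step vectors defeat
compactness, the absence of nonzero fixed vectors defeats mean ergodicity, and the first two
coordinates of an orbit defeat supercyclicity. -/

namespace HahnSpace

/-! ### Coordinates, functionals and test vectors of `h_d` -/

variable {w : HahnWeight}

theorem weight_nonneg (w : HahnWeight) (n : ℕ) : 0 ≤ w.d n := zero_le_one.trans (w.one_le n)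

/-- The `N`-th coordinate is controlled by the norm, with constant `1 / d_N`. -/
theorem weight_mul_norm_seq_le (x : HahnSpace w) (N : ℕ) : w.d N * ‖x.seq N‖ ≤ ‖x‖ := by
  have hlim : Tendsto (fun M => w.d N * ‖x.seq N - x.seq M‖) atTop
      (𝓝 (w.d N * ‖x.seq N - 0‖)) :=
    ((tendsto_const_nhds.sub x.seq_mem.1).norm).const_mul _
  rw [sub_zero] at hlim
  refine le_of_tendsto hlim ?_
  filter_upwards [eventually_ge_atTop N] with M hM
  have h1 : ‖x.seq N - x.seq M‖ ≤ ∑ k ∈ Finset.Ico N M, ‖x.seq (k + 1) - x.seq k‖ := by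
    rw [← dist_eq_norm]
    refine (dist_le_Ico_sum_dist x.seq hM).trans_eq (Finset.sum_congr rfl fun k _ => ?_)
    rw [dist_comm, dist_eq_norm]
  calc w.d N * ‖x.seq N - x.seq M‖
      ≤ w.d N * ∑ k ∈ Finset.Ico N M, ‖x.seq (k + 1) - x.seq k‖ :=
        mul_le_mul_of_nonneg_left h1 (weight_nonneg w N)
    _ = ∑ k ∈ Finset.Ico N M, w.d N * ‖x.seq (k + 1) - x.seq k‖ := Finset.mul_sum _ _ _
    _ ≤ ∑ k ∈ Finset.Ico N M, w.d k * ‖x.seq (k + 1) - x.seq k‖ := by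
        refine Finset.sum_le_sum fun k hk => ?_
        exact mul_le_mul_of_nonneg_right (w.mono (Finset.mem_Ico.1 hk).1) (norm_nonneg _)
    _ ≤ ‖x‖ := x.seq_mem.2.sum_le_tsum _ fun k _ => x.term_nonneg k

theorem norm_seq_le (x : HahnSpace w) (n : ℕ) : ‖x.seq n‖ ≤ ‖x‖ :=
  (le_mul_of_one_le_left (norm_nonneg _) (w.one_le n)).trans (x.weight_mul_norm_seq_le n)

/-- The coordinate functionals. -/
noncomputable def coord (w : HahnWeight) (n : ℕ) : HahnSpace w →L[ℂ] ℂ :=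
  LinearMap.mkContinuous
    { toFun := fun x => x.seq n
      map_add' := fun _ _ => rfl
      map_smul' := fun _ _ => rfl } 1 fun x => (x.norm_seq_le n).trans_eq (one_mul _).symm

@[simp] theorem coord_apply (n : ℕ) (x : HahnSpace w) : coord w n x = x.seq n := rfl

/-- The functional `x ↦ ∑ uₙ xₙ` for a summable sequence `u`. -/
noncomputable def functionalOfSummable (w : HahnWeight) (u : ℕ → ℂ) (hu : Summable fun n => ‖u n‖) :
    StrongDual ℂ (HahnSpace w) :=
  have hs : ∀ x : HahnSpace w, Summable fun n => ‖u n * x.seq n‖ := fun x =>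
    Summable.of_nonneg_of_le (fun _ => norm_nonneg _)
      (fun n => (norm_mul_le _ _).trans
        (mul_le_mul_of_nonneg_left (x.norm_seq_le n) (norm_nonneg _))) (hu.mul_right ‖x‖)
  LinearMap.mkContinuous
    { toFun := fun x => ∑' n, u n * x.seq n
      map_add' := fun x y => by
        rw [← (hs x).of_norm.tsum_add (hs y).of_norm]
        exact tsum_congr fun n => by simp [mul_add]
      map_smul' := fun c x => by
        simp only [seq_smul, Pi.smul_apply, smul_eq_mul, RingHom.id_apply]
        rw [← tsum_mul_left]
        exact tsum_congr fun n => by ring }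
    (∑' n, ‖u n‖) fun x => by
      refine (norm_tsum_le_tsum_norm (hs x)).trans ?_
      rw [← tsum_mul_right]
      exact (hs x).tsum_le_tsum (fun n => (norm_mul_le _ _).trans
        (mul_le_mul_of_nonneg_left (x.norm_seq_le n) (norm_nonneg _))) (hu.mul_right ‖x‖)

theorem functionalOfSummable_hasSum (u : ℕ → ℂ) (hu : Summable fun n => ‖u n‖)
    (x : HahnSpace w) :
    HasSum (fun n => u n * x.seq n) (functionalOfSummable w u hu x) :=
  (Summable.of_norm (Summable.of_nonneg_of_le (fun _ => norm_nonneg _)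
      (fun n => (norm_mul_le _ _).trans
        (mul_le_mul_of_nonneg_left (x.norm_seq_le n) (norm_nonneg _)))
      (hu.mul_right ‖x‖))).hasSum

theorem mem_of_finite_support {x : ℕ → ℂ} {N : ℕ} (h : ∀ n, N ≤ n → x n = 0) :
    x ∈ hahnSubmodule w := by
  refine ⟨tendsto_const_nhds.congr' ?_, summable_of_ne_finset_zero (s := Finset.range N) ?_⟩
  · filter_upwards [eventually_ge_atTop N] with n hn using (h n hn).symm
  · intro k hk
    have hk' : N ≤ k := by simpa using hk
    simp [h k hk', h (k + 1) (by omega)]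

/-- The unit vectors. -/
def basisVec (w : HahnWeight) (n : ℕ) : HahnSpace w :=
  mk (Pi.single n 1) (mem_of_finite_support (N := n + 1) fun k hk => by
    rw [Pi.single_eq_of_ne (by omega)])

@[simp] theorem basisVec_seq (n : ℕ) : (basisVec w n).seq = Pi.single n 1 := rfl

/-- The indicator sequence of `{0, …, N}`. -/
def stepVec (w : HahnWeight) (N : ℕ) : HahnSpace w :=
  mk (fun n => if n ≤ N then 1 else 0) (mem_of_finite_support (N := N + 1) fun k hk => by
    rw [if_neg (by omega)])

theorem stepVec_seq (N n : ℕ) : (stepVec w N).seq n = if n ≤ N then 1 else 0 := rfl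

theorem norm_stepVec (N : ℕ) : ‖stepVec w N‖ = w.d N := by
  rw [norm_def, tsum_eq_single N]
  · simp [stepVec_seq]
  · intro k hk
    rcases lt_or_gt_of_ne hk with h | h
    · simp [stepVec_seq, h.le, Nat.succ_le_of_lt h]
    · simp [stepVec_seq, not_le.2 h, not_le.2 (h.trans (Nat.lt_succ_self k))]

end HahnSpace

/-! ### Boundedness of the Cesàro operator and absence of eigenvectors -/

section Cesaro

theorem norm_natCast_add_one (n : ℕ) : ‖(n : ℂ) + 1‖ = (n : ℝ) + 1 := by
  rw [← Nat.cast_add_one, Complex.norm_natCast, Nat.cast_add_one]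

theorem cesaroMean_add (x y : ℕ → ℂ) : cesaroMean (x + y) = cesaroMean x + cesaroMean y := by
  funext n
  simp [cesaroMean, Finset.sum_add_distrib, add_div]

theorem cesaroMean_smul (c : ℂ) (x : ℕ → ℂ) : cesaroMean (c • x) = c • cesaroMean x := by
  funext n
  simp [cesaroMean, ← Finset.mul_sum, mul_div_assoc]

theorem cesaroMean_mul (x : ℕ → ℂ) (n : ℕ) :
    cesaroMean x n * ((n : ℂ) + 1) = ∑ k ∈ Finset.range (n + 1), x k :=
  div_mul_cancel₀ _ (Nat.cast_add_one_ne_zero n)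

theorem cesaroMean_tendsto_zero {x : ℕ → ℂ} (hx : Tendsto x atTop (𝓝 0)) :
    Tendsto (cesaroMean x) atTop (𝓝 0) := by
  refine ((tendsto_add_atTop_iff_nat 1).2 hx.cesaro_smul).congr fun n => ?_
  rw [cesaroMean, Complex.real_smul, div_eq_inv_mul]
  push_cast
  rfl

theorem sum_succ_mul_sub (x : ℕ → ℂ) (n : ℕ) :
    ∑ k ∈ Finset.range n, ((k : ℂ) + 1) * (x (k + 1) - x k)
      = n * x n - ∑ k ∈ Finset.range n, x k := by
  induction n with
  | zero => simp
  | succ n ih =>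
    rw [Finset.sum_range_succ, ih, Finset.sum_range_succ]
    push_cast
    ring

theorem cesaroMean_succ_sub (x : ℕ → ℂ) (n : ℕ) :
    cesaroMean x (n + 1) - cesaroMean x n
      = (∑ k ∈ Finset.range (n + 1), ((k : ℂ) + 1) * (x (k + 1) - x k))
        / (((n : ℂ) + 1) * (n + 2)) := by
  have h1 : (n : ℂ) + 1 ≠ 0 := Nat.cast_add_one_ne_zero n
  have h2 : (n : ℂ) + 2 ≠ 0 := by exact_mod_cast Nat.succ_ne_zero (n + 1)
  have h3 : (n : ℂ) + 1 + 1 ≠ 0 := by exact_mod_cast Nat.succ_ne_zero (n + 1)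
  rw [sum_succ_mul_sub, cesaroMean, cesaroMean, Finset.sum_range_succ x (n + 1)]
  push_cast
  field_simp
  ring

theorem norm_cesaroMean_succ_sub_le (x : ℕ → ℂ) (n : ℕ) :
    ‖cesaroMean x (n + 1) - cesaroMean x n‖
      ≤ (∑ k ∈ Finset.range (n + 1), ((k : ℝ) + 1) * ‖x (k + 1) - x k‖)
        / (((n : ℝ) + 1) * (n + 2)) := by
  have h1 : ‖((n : ℂ) + 1) * (n + 2)‖ = ((n : ℝ) + 1) * (n + 2) := by
    have : ((n : ℂ) + 1) * (n + 2) = (((n + 1) * (n + 2) : ℕ) : ℂ) := by push_cast; ring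
    rw [this, Complex.norm_natCast]
    push_cast
    ring
  rw [cesaroMean_succ_sub, norm_div, h1]
  refine div_le_div_of_nonneg_right ((norm_sum_le _ _).trans_eq ?_) (by positivity)
  refine Finset.sum_congr rfl fun k _ => ?_
  rw [norm_mul, norm_natCast_add_one]

/-- Abel summation; the boundary term stands apart so that it can be dropped when `a` and `b` are
nonnegative. -/
theorem sum_sub_mul_add_eq_sum (a b : ℕ → ℝ) (N : ℕ) :
    ∑ n ∈ Finset.range N, (a n - a (n + 1)) * ∑ k ∈ Finset.range (n + 1), b k
      + a N * ∑ k ∈ Finset.range N, b k = ∑ n ∈ Finset.range N, a n * b n := by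
  induction N with
  | zero => simp
  | succ N ih =>
    rw [Finset.sum_range_succ, Finset.sum_range_succ (fun n => a n * b n), ← ih,
      Finset.sum_range_succ b]
    ring

/-- After clearing denominators this says `(n + 1) (d (n + 1) - d n) ≤ 1`, the slow growth of the
logarithm. The extra 1 in the numerators pays for the increment of `d`. -/
theorem logWeight_div_le (n : ℕ) :
    logWeight.d n / (((n : ℝ) + 1) * (n + 2))
      ≤ (logWeight.d n + 1) / ((n : ℝ) + 1) - (logWeight.d (n + 1) + 1) / (((n + 1 : ℕ) : ℝ) + 1) := by
  have hn : (0 : ℝ) ≤ n := Nat.cast_nonneg n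
  have h : logWeight.d (n + 1) - logWeight.d n ≤ 1 / ((n : ℝ) + 1) := by
    change Real.log (((n + 1 : ℕ) : ℝ) + 3) - Real.log ((n : ℝ) + 3) ≤ _
    rw [← Real.log_div (by positivity) (by positivity)]
    refine (Real.log_le_sub_one_of_pos (by positivity)).trans ?_
    push_cast
    rw [div_sub_one (by positivity)]
    refine (div_le_div_iff₀ (by positivity) (by positivity)).2 ?_
    nlinarith
  rw [le_div_iff₀ (by positivity)] at h
  push_cast
  rw [div_sub_div _ _ (by positivity) (by positivity),
    div_le_div_iff₀ (by positivity) (by positivity)]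
  have h2 : 0 ≤ ((n : ℝ) + 1) * (n + 2) := by positivity
  nlinarith [mul_le_mul_of_nonneg_left h h2]

theorem sum_logWeight_mul_norm_cesaroMean_le (x : HahnSpace logWeight) (N : ℕ) :
    ∑ n ∈ Finset.range N, logWeight.d n * ‖cesaroMean x.seq (n + 1) - cesaroMean x.seq n‖
      ≤ 2 * ‖x‖ := by
  set a : ℕ → ℝ := fun n => (logWeight.d n + 1) / ((n : ℝ) + 1) with ha
  set b : ℕ → ℝ := fun k => ((k : ℝ) + 1) * ‖x.seq (k + 1) - x.seq k‖ with hb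
  have hb0 : ∀ k, 0 ≤ b k := fun k => by positivity
  have hd := HahnSpace.weight_nonneg logWeight
  calc _ ≤ ∑ n ∈ Finset.range N, (a n - a (n + 1)) * ∑ k ∈ Finset.range (n + 1), b k := by
        refine Finset.sum_le_sum fun n _ => ?_
        refine (mul_le_mul_of_nonneg_left (norm_cesaroMean_succ_sub_le x.seq n) (hd n)).trans ?_
        rw [mul_div_assoc', mul_div_right_comm]
        exact mul_le_mul_of_nonneg_right (logWeight_div_le n)
          (Finset.sum_nonneg fun k _ => hb0 k)
    _ ≤ ∑ n ∈ Finset.range N, a n * b n := by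
        rw [← sum_sub_mul_add_eq_sum a b N]
        refine le_add_of_nonneg_right (mul_nonneg ?_ (Finset.sum_nonneg fun k _ => hb0 k))
        have := hd N
        positivity
    _ ≤ ∑ n ∈ Finset.range N, 2 * (logWeight.d n * ‖x.seq (n + 1) - x.seq n‖) := by
        refine Finset.sum_le_sum fun n _ => ?_
        have h1 : a n * b n = (logWeight.d n + 1) * ‖x.seq (n + 1) - x.seq n‖ := by
          simp only [ha, hb]
          field_simp
        rw [h1, ← mul_assoc]
        refine mul_le_mul_of_nonneg_right ?_ (norm_nonneg _)
        linarith [logWeight.one_le n]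
    _ ≤ 2 * ‖x‖ := by
        rw [← Finset.mul_sum]
        exact mul_le_mul_of_nonneg_left
          (x.seq_mem.2.sum_le_tsum _ fun k _ => x.term_nonneg k) zero_le_two

theorem cesaroMean_mem (x : HahnSpace logWeight) :
    cesaroMean x.seq ∈ hahnSubmodule logWeight :=
  ⟨cesaroMean_tendsto_zero x.seq_mem.1, summable_of_sum_range_le
    (fun n => mul_nonneg (HahnSpace.weight_nonneg logWeight n) (norm_nonneg _))
    (sum_logWeight_mul_norm_cesaroMean_le x)⟩

/-- The Cesàro operator on `h_d` for `dₙ = log (n + 3)`. -/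
noncomputable def cesaroOperator : HahnSpace logWeight →L[ℂ] HahnSpace logWeight :=
  LinearMap.mkContinuous
    { toFun := fun x => HahnSpace.mk (cesaroMean x.seq) (cesaroMean_mem x)
      map_add' := fun x y => HahnSpace.ext_seq (cesaroMean_add x.seq y.seq)
      map_smul' := fun c x => HahnSpace.ext_seq (cesaroMean_smul c x.seq) } 2 fun x =>
    (cesaroMean_mem x).2.tsum_le_of_sum_range_le (sum_logWeight_mul_norm_cesaroMean_le x)

@[simp] theorem cesaroOperator_seq (x : HahnSpace logWeight) :
    (cesaroOperator x).seq = cesaroMean x.seq := rfl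

/-- The Cesàro averaging has no eigenvector among the null sequences. -/
theorem eq_zero_of_cesaroMean_eq_smul {x : ℕ → ℂ} {z : ℂ} (hx : Tendsto x atTop (𝓝 0))
    (h : cesaroMean x = z • x) : x = 0 := by
  classical
  by_contra hne
  have hex : ∃ n, x n ≠ 0 := Function.ne_iff.1 hne
  obtain ⟨m, hm, hmin⟩ : ∃ m, x m ≠ 0 ∧ ∀ k < m, x k = 0 :=
    ⟨Nat.find hex, Nat.find_spec hex, fun k hk => not_not.1 (Nat.find_min hex hk)⟩
  have hsum : ∀ n : ℕ, z * x n * ((n : ℂ) + 1) = ∑ k ∈ Finset.range (n + 1), x k := fun n => by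
    rw [← cesaroMean_mul, h, Pi.smul_apply, smul_eq_mul]
  have hz : z * ((m : ℂ) + 1) = 1 := by
    have h1 := hsum m
    rw [Finset.sum_range_succ,
      Finset.sum_eq_zero fun k hk => hmin k (Finset.mem_range.1 hk), zero_add] at h1
    exact mul_right_cancel₀ hm (by linear_combination h1)
  -- Subtracting consecutive sum identities and eliminating `z` by `hz` gives the ratio `(m + j + 1)
  -- / (j + 1)`, which is at least 1.
  have hrec : ∀ j : ℕ, x (m + j + 1) * ((j : ℂ) + 1) = ((m : ℂ) + j + 1) * x (m + j) := fun j => by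
    have h1 := hsum (m + j + 1)
    rw [Finset.sum_range_succ, ← hsum (m + j)] at h1
    push_cast at h1
    linear_combination ((m : ℂ) + 1) * h1
      + (((m : ℂ) + j + 1) * x (m + j) - ((m : ℂ) + j + 2) * x (m + j + 1)) * hz
  have hmono : ∀ j : ℕ, ‖x m‖ ≤ ‖x (m + j)‖ := fun j => by
    induction j with
    | zero => simp
    | succ j ih =>
      refine ih.trans ?_
      have h1 := congrArg norm (hrec j)
      have e2 : ‖(m : ℂ) + j + 1‖ = (m : ℝ) + j + 1 := by
        have : (m : ℂ) + j + 1 = ((m + j + 1 : ℕ) : ℂ) := by push_cast; ring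
        rw [this, Complex.norm_natCast]; push_cast; ring
      rw [norm_mul, norm_mul, norm_natCast_add_one, e2] at h1
      have h2 : (0 : ℝ) < (j : ℝ) + 1 := by positivity
      refine le_of_mul_le_mul_right ?_ h2
      rw [← add_assoc, h1]
      nlinarith [mul_nonneg (Nat.cast_nonneg (α := ℝ) m) (norm_nonneg (x (m + j)))]
  have hlim : Tendsto (fun j => ‖x (m + j)‖) atTop (𝓝 0) := by
    have := (hx.comp (tendsto_add_atTop_nat m)).norm
    rw [norm_zero] at this
    exact this.congr fun j => by simp [add_comm]
  exact (norm_pos_iff.2 hm).not_ge (ge_of_tendsto' hlim hmono)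

theorem cesaroOperator_eigen_eq_zero {x : HahnSpace logWeight} {z : ℂ}
    (h : cesaroOperator x = z • x) : x = 0 :=
  HahnSpace.ext_seq (eq_zero_of_cesaroMean_eq_smul x.seq_mem.1 (congrArg HahnSpace.seq h))

theorem injective_smul_id_sub_cesaroOperator (z : ℂ) :
    Function.Injective
      (z • ContinuousLinearMap.id ℂ (HahnSpace logWeight) - cesaroOperator) := by
  rw [injective_iff_map_eq_zero]
  intro x hx
  exact cesaroOperator_eigen_eq_zero (sub_eq_zero.1 hx).symm

end Cesaro

/-! ### Eigenvectors of the transposed Cesàro matrix -/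

section DualEigenvectors

/-- The sequence `uₙ = ∏_{j=1}^n (1 - μ / j)`, an eigenvector of the transposed Cesàro matrix for
the eigenvalue `1 / μ`. -/
noncomputable def cesaroDualSeq (μ : ℂ) (n : ℕ) : ℂ := ∏ j ∈ Finset.range n, (1 - μ / ((j : ℂ) + 1))

@[simp] theorem cesaroDualSeq_zero (μ : ℂ) : cesaroDualSeq μ 0 = 1 := by simp [cesaroDualSeq]

theorem cesaroDualSeq_succ (μ : ℂ) (n : ℕ) :
    cesaroDualSeq μ (n + 1) = cesaroDualSeq μ n * (1 - μ / ((n : ℂ) + 1)) := by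
  simp [cesaroDualSeq, Finset.prod_range_succ]

theorem cesaroDualSeq_succ_mul (μ : ℂ) (n : ℕ) :
    ((n : ℂ) + 1) * cesaroDualSeq μ (n + 1) = ((n : ℂ) + 1 - μ) * cesaroDualSeq μ n := by
  have : (n : ℂ) + 1 ≠ 0 := Nat.cast_add_one_ne_zero n
  rw [cesaroDualSeq_succ]
  field_simp

theorem exists_norm_natCast_add_one_sub_le {μ : ℂ} (hμ : 1 < μ.re) :
    ∃ c > 0, ∀ᶠ n : ℕ in atTop, ‖(n : ℂ) + 1 - μ‖ ≤ n - c := by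
  -- The modulus is asymptotically `n - 2c`; giving up one `c` absorbs the term `‖μ‖ ^ 2` once `2 c
  -- n` exceeds it.
  obtain ⟨c, hc, hc'⟩ : ∃ c : ℝ, 0 < c ∧ 1 + 2 * c = μ.re := ⟨(μ.re - 1) / 2, by linarith, by ring⟩
  refine ⟨c, hc, ?_⟩
  filter_upwards [tendsto_natCast_atTop_atTop.eventually_ge_atTop c,
    tendsto_natCast_atTop_atTop.eventually_ge_atTop (‖μ‖ ^ 2 / (2 * c))] with n h1 h2
  refine le_of_sq_le_sq ?_ (sub_nonneg.2 h1)
  rw [div_le_iff₀ (by positivity)] at h2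
  rw [Complex.sq_norm, Complex.normSq_apply] at h2 ⊢
  simp only [Complex.sub_re, Complex.add_re, Complex.natCast_re, Complex.one_re, Complex.sub_im,
    Complex.add_im, Complex.natCast_im, Complex.one_im]
  rw [← hc'] at h2 ⊢
  nlinarith

/-- Raabe's criterion for the eigenvectors of the transposed Cesàro matrix. -/
theorem cesaroDualSeq_summable_and_bounded {μ : ℂ} (hμ : 1 < μ.re) :
    (Summable fun n => ‖cesaroDualSeq μ n‖) ∧
      ∃ B : ℝ, ∀ᶠ n : ℕ in atTop, (n : ℝ) * ‖cesaroDualSeq μ n‖ ≤ B := by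
  obtain ⟨c, hc, hev⟩ := exists_norm_natCast_add_one_sub_le hμ
  obtain ⟨N, hN⟩ := eventually_atTop.1 hev
  set v : ℕ → ℝ := fun n => ‖cesaroDualSeq μ n‖ with hv
  -- Telescoping this inequality bounds both `n * v n` and the partial sums of `v`.
  have hstep : ∀ n : ℕ, N ≤ n → ((n : ℝ) + 1) * v (n + 1) + c * v n ≤ n * v n := fun n hn => by
    have h1 := congrArg norm (cesaroDualSeq_succ_mul μ n)
    rw [norm_mul, norm_mul, norm_natCast_add_one] at h1
    have h2 := mul_le_mul_of_nonneg_right (hN n hn) (norm_nonneg (cesaroDualSeq μ n))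
    simp only [hv]
    linarith
  have hpart : ∀ j : ℕ, ((N + j : ℕ) : ℝ) * v (N + j) + c * ∑ i ∈ Finset.range j, v (i + N)
      ≤ N * v N := fun j => by
    induction j with
    | zero => simp
    | succ j ih =>
      rw [Finset.sum_range_succ, add_comm j N]
      have h1 := hstep (N + j) (by omega)
      push_cast at h1 ih ⊢
      rw [← add_assoc N j 1]
      linarith
  have hv0 : ∀ n, 0 ≤ v n := fun n => norm_nonneg _
  refine ⟨?_, N * v N, ?_⟩
  · rw [← summable_nat_add_iff N]
    refine summable_of_sum_range_le (c := N * v N / c) (fun n => hv0 _) fun j => ?_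
    rw [le_div_iff₀' hc]
    have h1 : 0 ≤ ((N + j : ℕ) : ℝ) * v (N + j) := mul_nonneg (Nat.cast_nonneg _) (hv0 _)
    linarith [hpart j]
  · filter_upwards [eventually_ge_atTop N] with n hn
    obtain ⟨j, rfl⟩ := Nat.exists_eq_add_of_le hn
    have h1 : 0 ≤ c * ∑ i ∈ Finset.range j, v (i + N) :=
      mul_nonneg hc.le (Finset.sum_nonneg fun i _ => hv0 _)
    linarith [hpart j]

/-- The eigenvector equation in truncated form, avoiding any interchange of infinite sums; the last
term is the truncation error. -/
theorem sum_cesaroDualSeq_mul_cesaroMean (μ : ℂ) (x : ℕ → ℂ) (N : ℕ) :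
    μ * ∑ n ∈ Finset.range N, cesaroDualSeq μ n * cesaroMean x n
      = ∑ n ∈ Finset.range N, cesaroDualSeq μ n * x n
        - cesaroDualSeq μ N * ∑ k ∈ Finset.range N, x k := by
  induction N with
  | zero => simp
  | succ N ih =>
    have h1 : (N : ℂ) + 1 ≠ 0 := Nat.cast_add_one_ne_zero N
    rw [Finset.sum_range_succ, mul_add, ih, Finset.sum_range_succ (fun n => cesaroDualSeq μ n * x n),
      cesaroDualSeq_succ, cesaroMean, Finset.sum_range_succ x N]
    field_simp
    ring

theorem mul_functionalOfSummable_cesaroOperator {μ : ℂ} (hμ : 1 < μ.re)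
    (x : HahnSpace logWeight) :
    μ * HahnSpace.functionalOfSummable logWeight (cesaroDualSeq μ)
        (cesaroDualSeq_summable_and_bounded hμ).1 (cesaroOperator x)
      = HahnSpace.functionalOfSummable logWeight (cesaroDualSeq μ)
        (cesaroDualSeq_summable_and_bounded hμ).1 x := by
  obtain ⟨hs, B, hB⟩ := cesaroDualSeq_summable_and_bounded hμ
  have h1 := ((HahnSpace.functionalOfSummable_hasSum _ hs
    (cesaroOperator x)).tendsto_sum_nat).const_mul μ
  have h2 := (HahnSpace.functionalOfSummable_hasSum _ hs x).tendsto_sum_nat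
  -- A bounded factor `N * ‖u N‖` times the average of a null sequence.
  have h3 : Tendsto (fun N => cesaroDualSeq μ N * ∑ k ∈ Finset.range N, x.seq k) atTop (𝓝 0) := by
    have hc := x.seq_mem.1.cesaro_smul.norm.const_mul B
    rw [norm_zero, mul_zero] at hc
    refine squeeze_zero_norm' ?_ hc
    filter_upwards [hB, eventually_gt_atTop 0] with N hN hpos
    have hpos' : (0 : ℝ) < N := by exact_mod_cast hpos
    calc ‖cesaroDualSeq μ N * ∑ k ∈ Finset.range N, x.seq k‖
        = (N * ‖cesaroDualSeq μ N‖) * ‖(N : ℝ)⁻¹ • ∑ k ∈ Finset.range N, x.seq k‖ := by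
          rw [norm_smul, norm_mul, norm_inv, Real.norm_natCast]
          field_simp
      _ ≤ _ := mul_le_mul_of_nonneg_right hN (norm_nonneg _)
  have h4 := h2.sub h3
  rw [sub_zero] at h4
  refine tendsto_nhds_unique h1 (h4.congr fun N => ?_)
  rw [cesaroOperator_seq, sum_cesaroDualSeq_mul_cesaroMean]

end DualEigenvectors

/-! ### Dual operators, spectra and ergodic means in general -/

section DualOperators

variable {X : Type*} [NormedAddCommGroup X] [NormedSpace ℂ X]

@[simp] theorem dualOperator_apply (T : X →L[ℂ] X) (u : StrongDual ℂ X) (x : X) :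
    dualOperator T u x = u (T x) := rfl

theorem mem_pointSpectrum_iff {T : X →L[ℂ] X} {z : ℂ} :
    z ∈ pointSpectrum T ↔ ∃ x, x ≠ 0 ∧ T x = z • x := by
  rw [pointSpectrum, Set.mem_ofPred_eq, injective_iff_map_eq_zero]
  push Not
  refine exists_congr fun x => ?_
  rw [and_comm]
  refine and_congr_right fun _ => ?_
  change z • x - T x = 0 ↔ _
  rw [sub_eq_zero, eq_comm]

theorem not_denseRange_of_mem_pointSpectrum_dualOperator {T : X →L[ℂ] X} {z : ℂ}
    (hz : z ∈ pointSpectrum (dualOperator T)) :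
    ¬ DenseRange (z • ContinuousLinearMap.id ℂ X - T) := by
  obtain ⟨u, hu, h⟩ := mem_pointSpectrum_iff.1 hz
  intro hd
  refine hu (ContinuousLinearMap.ext fun x => ?_)
  refine congrFun (hd.equalizer u.continuous (continuous_const (y := (0 : ℂ))) ?_) x
  funext y
  have h1 : u (T y) = z * u y := congrArg (fun v : StrongDual ℂ X => v y) h
  change u (z • y - T y) = 0
  rw [map_sub, map_smul, h1, smul_eq_mul, sub_self]

theorem pointSpectrum_subset_spectrum (T : X →L[ℂ] X) : pointSpectrum T ⊆ spectrum ℂ T := by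
  intro z hz hu
  obtain ⟨x, hx, h⟩ := mem_pointSpectrum_iff.1 hz
  obtain ⟨S, hS⟩ := hu.exists_left_inv
  refine hx ?_
  have h1 : S ((algebraMap ℂ (X →L[ℂ] X) z - T) x) = x :=
    congrArg (fun R : X →L[ℂ] X => R x) hS
  have h2 : (algebraMap ℂ (X →L[ℂ] X) z - T) x = 0 := by
    simp [Algebra.algebraMap_eq_smul_one, h]
  rw [← h1, h2, map_zero]

/-- Dualising reverses products, so left and right inverses trade places. The gain is that the dual
is complete even if `X` is not, so its operators have closed spectrum. -/
theorem spectrum_dualOperator_subset (T : X →L[ℂ] X) :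
    spectrum ℂ (dualOperator T) ⊆ spectrum ℂ T := by
  intro z hz hu
  refine hz ?_
  obtain ⟨S, hS⟩ := hu.exists_left_inv
  obtain ⟨R, hR⟩ := hu.exists_right_inv
  refine isUnit_iff_exists_and_exists.2 ⟨⟨dualOperator S, ?_⟩, ⟨dualOperator R, ?_⟩⟩
  · ext u x
    have h : S (z • x - T x) = x := congrArg (fun Q : X →L[ℂ] X => Q x) hS
    change z • u (S x) - u (S (T x)) = u x
    rw [← map_smul, ← map_smul, ← map_sub, ← map_sub, h]
  · ext u x
    have h : z • R x - T (R x) = x := congrArg (fun Q : X →L[ℂ] X => Q x) hR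
    change z • u (R x) - u (T (R x)) = u x
    rw [← map_smul, ← map_sub, h]

/-- The limit of the Cesàro means of a mean ergodic operator consists of fixed vectors. -/
theorem map_eq_of_tendsto_means {T P : X →L[ℂ] X}
    (h : ∀ x : X, Tendsto (fun n : ℕ => ((n : ℂ)⁻¹ • ∑ m ∈ Finset.Icc 1 n, T ^ m) x) atTop
      (𝓝 (P x))) (x : X) : T (P x) = P x := by
  set A : ℕ → X := fun n => ((n : ℂ)⁻¹ • ∑ m ∈ Finset.Icc 1 n, T ^ m) x with hA
  have hinv : Tendsto (fun n : ℕ => (n : ℂ)⁻¹) atTop (𝓝 0) := tendsto_inv_atTop_nhds_zero_nat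
  have h1 : Tendsto (fun n => T (A n)) atTop (𝓝 (T (P x))) :=
    (T.continuous.tendsto _).comp (h x)
  -- For `n > 0` this expression equals `T (A n)`.
  have h2 : Tendsto (fun n : ℕ => (1 + (n : ℂ)⁻¹) • A (n + 1) - (n : ℂ)⁻¹ • T x) atTop
      (𝓝 ((1 + (0 : ℂ)) • P x - (0 : ℂ) • T x)) :=
    ((tendsto_const_nhds.add hinv).smul ((tendsto_add_atTop_iff_nat 1).2 (h x))).sub
      (hinv.smul_const _)
  rw [add_zero, one_smul, zero_smul, sub_zero] at h2
  refine tendsto_nhds_unique h1 (h2.congr' ?_)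
  filter_upwards [eventually_gt_atTop 0] with n hn
  have hn' : (n : ℂ) ≠ 0 := by exact_mod_cast hn.ne'
  have hn1 : (n : ℂ) + 1 ≠ 0 := Nat.cast_add_one_ne_zero n
  have hsum : ∀ k : ℕ, T (∑ m ∈ Finset.Icc 1 k, (T ^ m) x) + T x
      = ∑ m ∈ Finset.Icc 1 (k + 1), (T ^ m) x := fun k => by
    induction k with
    | zero => simp
    | succ k ih =>
      rw [Finset.sum_Icc_succ_top (by omega), map_add, add_right_comm, ih,
        Finset.sum_Icc_succ_top (by omega : 1 ≤ k + 1 + 1), pow_succ' T (k + 1),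
        mul_apply_eq_comp]
  simp only [hA, smul_apply, sum_apply, map_smul]
  rw [smul_smul, ← hsum]
  have e : (1 + (n : ℂ)⁻¹) * ((n + 1 : ℕ) : ℂ)⁻¹ = (n : ℂ)⁻¹ := by
    push_cast
    field_simp
  rw [e, smul_add, add_sub_cancel_right]

end DualOperators

/-! ### Spectrum, non-compactness and dynamics of the Cesàro operator -/

section CesaroSpectrum

theorem one_mem_pointSpectrum_dualOperator :
    (1 : ℂ) ∈ pointSpectrum (dualOperator cesaroOperator) := by
  refine mem_pointSpectrum_iff.2 ⟨HahnSpace.coord logWeight 0, fun h => ?_, ?_⟩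
  · have := congrArg (fun u : StrongDual ℂ (HahnSpace logWeight) =>
      u (HahnSpace.basisVec logWeight 0)) h
    simp at this
  · ext x
    simp [cesaroMean]

/-- The disc is the set where `normSq z < z.re`; dividing by `normSq z` gives the half-plane. -/
theorem one_lt_re_inv {z : ℂ} (hz : z ∈ Metric.ball (1 / 2 : ℂ) (1 / 2)) : 1 < (z⁻¹).re := by
  rw [Metric.mem_ball, dist_eq_norm] at hz
  have h1 : ‖z - 1 / 2‖ ^ 2 < (1 / 2) ^ 2 := by gcongr
  rw [Complex.sq_norm, Complex.normSq_apply] at h1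
  norm_num at h1
  have h2 : Complex.normSq z < z.re := by
    rw [Complex.normSq_apply]
    nlinarith
  have h3 : 0 < Complex.normSq z := by
    refine Complex.normSq_pos.2 ?_
    rintro rfl
    simp at h2
  rw [Complex.inv_re, lt_div_iff₀ h3, one_mul]
  exact h2

theorem ball_subset_pointSpectrum_dualOperator :
    Metric.ball (1 / 2 : ℂ) (1 / 2) ⊆ pointSpectrum (dualOperator cesaroOperator) := by
  intro z hz
  have hre := one_lt_re_inv hz
  have hz0 : z ≠ 0 := by
    rintro rfl
    norm_num at hre
  refine mem_pointSpectrum_iff.2 ⟨HahnSpace.functionalOfSummable logWeight (cesaroDualSeq z⁻¹)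
    (cesaroDualSeq_summable_and_bounded hre).1, fun h => ?_, ?_⟩
  · have h1 := HahnSpace.functionalOfSummable_hasSum (w := logWeight) _
      (cesaroDualSeq_summable_and_bounded hre).1 (HahnSpace.basisVec logWeight 0)
    rw [h] at h1
    have h2 := h1.unique (hasSum_single 0 fun k hk => by simp [hk])
    simp at h2
  · ext x
    have h1 := mul_functionalOfSummable_cesaroOperator hre x
    rw [dualOperator_apply, smul_apply, ← h1, smul_eq_mul,
      mul_inv_cancel_left₀ hz0]

theorem closedBall_subset_spectrum_cesaroOperator :
    Metric.closedBall (1 / 2 : ℂ) (1 / 2) ⊆ spectrum ℂ cesaroOperator := by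
  refine Set.Subset.trans ?_ (spectrum_dualOperator_subset cesaroOperator)
  rw [← closure_ball (1 / 2 : ℂ) (by norm_num : (1 / 2 : ℝ) ≠ 0)]
  exact closure_minimal (ball_subset_pointSpectrum_dualOperator.trans
    (pointSpectrum_subset_spectrum _)) (spectrum.isClosed (𝕜 := ℂ) (dualOperator cesaroOperator))

theorem cesaroMean_stepVec (w : HahnWeight) (N : ℕ) :
    cesaroMean (HahnSpace.stepVec w N).seq N = 1 := by
  have h1 : (N : ℂ) + 1 ≠ 0 := Nat.cast_add_one_ne_zero N
  have h2 : ∑ k ∈ Finset.range (N + 1), (HahnSpace.stepVec w N).seq k = (N : ℂ) + 1 := by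
    rw [Finset.sum_congr rfl fun k hk => ?_, Finset.sum_const, Finset.card_range, nsmul_one]
    · push_cast
      rfl
    · rw [HahnSpace.stepVec_seq, if_pos (Nat.lt_succ_iff.1 (Finset.mem_range.1 hk))]
  rw [cesaroMean, h2, div_self h1]

theorem norm_cesaroMean_stepVec_le (w : HahnWeight) (N n : ℕ) :
    ‖cesaroMean (HahnSpace.stepVec w N).seq n‖ ≤ 1 := by
  rw [cesaroMean, norm_div, norm_natCast_add_one, div_le_one (by positivity)]
  refine (norm_sum_le_of_le _ (f := (HahnSpace.stepVec w N).seq) (n := fun _ => 1)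
    fun k _ => ?_).trans (by simp)
  rw [HahnSpace.stepVec_seq]
  split_ifs <;> simp

/-- The unit vectors `s N` have images tending to 0 in each coordinate, as `d N → ∞`, so any limit
point is 0. But coordinate `N` of the image is `1 / d N`, which forces norm at least 1. -/
theorem not_isCompactOperator_cesaroOperator : ¬ IsCompactOperator cesaroOperator := by
  intro hc
  obtain ⟨K, hK, hsub⟩ := hc.image_closedBall_subset_compact 1
  have hpos : ∀ N, 0 < logWeight.d N := fun N => zero_lt_one.trans_le (logWeight.one_le N)
  set s : ℕ → HahnSpace logWeight :=
    fun N => ((logWeight.d N : ℂ)⁻¹) • HahnSpace.stepVec logWeight N with hs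
  have hnorm : ∀ N, ‖(logWeight.d N : ℂ)⁻¹‖ = (logWeight.d N)⁻¹ := fun N => by
    rw [norm_inv, Complex.norm_real, Real.norm_of_nonneg (hpos N).le]
  have hmem : ∀ N, cesaroOperator (s N) ∈ K := fun N => by
    refine hsub ⟨s N, ?_, rfl⟩
    rw [mem_closedBall_zero_iff, norm_smul, hnorm, HahnSpace.norm_stepVec,
      inv_mul_cancel₀ (hpos N).ne']
  obtain ⟨y, -, φ, hφ, hlim⟩ := hK.tendsto_subseq hmem
  have hseq : ∀ N n, (cesaroOperator (s N)).seq n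
      = (logWeight.d N : ℂ)⁻¹ * cesaroMean (HahnSpace.stepVec logWeight N).seq n := fun N n => by
    rw [hs, map_smul, HahnSpace.seq_smul, Pi.smul_apply, smul_eq_mul, cesaroOperator_seq]
  have hy : y = 0 := by
    refine HahnSpace.ext_seq (funext fun n => ?_)
    have h1 : Tendsto (fun j => (cesaroOperator (s (φ j))).seq n) atTop (𝓝 (y.seq n)) :=
      ((HahnSpace.coord logWeight n).continuous.tendsto y).comp hlim
    refine tendsto_nhds_unique h1 (squeeze_zero_norm (fun j => ?_)
      ((logWeight.tendsto.comp hφ.tendsto_atTop).inv_tendsto_atTop))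
    rw [hseq, norm_mul, hnorm]
    exact mul_le_of_le_one_right (inv_nonneg.2 (hpos _).le) (norm_cesaroMean_stepVec_le _ _ _)
  have h2 : Tendsto (fun j => ‖cesaroOperator (s (φ j))‖) atTop (𝓝 0) := by
    rw [← norm_zero (E := HahnSpace logWeight), ← hy]
    exact hlim.norm
  refine absurd (ge_of_tendsto' h2 (b := 1) fun j => ?_) (by norm_num)
  have h3 := (cesaroOperator (s (φ j))).weight_mul_norm_seq_le (φ j)
  rwa [hseq, cesaroMean_stepVec, mul_one, hnorm, mul_inv_cancel₀ (hpos _).ne'] at h3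

theorem cesaroOperator_seq_zero (x : HahnSpace logWeight) :
    (cesaroOperator x).seq 0 = x.seq 0 := by
  simp [cesaroMean]

theorem cesaroOperator_pow_seq_zero (n : ℕ) (x : HahnSpace logWeight) :
    ((cesaroOperator ^ n) x).seq 0 = x.seq 0 := by
  induction n with
  | zero => rfl
  | succ n ih => rw [pow_succ', mul_apply_eq_comp, cesaroOperator_seq_zero, ih]

theorem cesaroOperator_pow_seq_zero_sub_one (n : ℕ) (x : HahnSpace logWeight) :
    ((cesaroOperator ^ n) x).seq 0 - ((cesaroOperator ^ n) x).seq 1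
      = (1 / 2) ^ n * (x.seq 0 - x.seq 1) := by
  induction n with
  | zero => simp
  | succ n ih =>
    rw [pow_succ', pow_succ', mul_apply_eq_comp, mul_assoc, ← ih]
    simp only [cesaroOperator_seq, cesaroMean, Finset.sum_range_succ, Finset.sum_range_zero]
    push_cast
    ring

/-- The limit would be a fixed vector, hence 0, whereas averaging preserves coordinate 0, which is 1
for the first unit vector. -/
theorem not_isMeanErgodic_cesaroOperator : ¬ IsMeanErgodic cesaroOperator := by
  rintro ⟨P, hP⟩
  set x := HahnSpace.basisVec logWeight 0 with hx
  have hPx : P x = 0 := by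
    refine cesaroOperator_eigen_eq_zero (z := 1) ?_
    rw [map_eq_of_tendsto_means hP, one_smul]
  have h1 := ((HahnSpace.coord logWeight 0).continuous.tendsto _).comp (hP x)
  rw [hPx, map_zero] at h1
  refine one_ne_zero (α := ℂ) (tendsto_nhds_unique (tendsto_const_nhds.congr' ?_) h1)
  filter_upwards [eventually_gt_atTop 0] with n hn
  have hn' : (n : ℂ) ≠ 0 := by exact_mod_cast hn.ne'
  simp only [Function.comp_apply, smul_apply, sum_apply, map_smul, map_sum,
    HahnSpace.coord_apply, cesaroOperator_pow_seq_zero, hx, HahnSpace.basisVec_seq,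
    Pi.single_eq_same, Finset.sum_const, Nat.card_Icc, add_tsub_cancel_right, nsmul_one,
    smul_eq_mul, inv_mul_cancel₀ hn']

theorem not_isSupercyclic_cesaroOperator : ¬ IsSupercyclic cesaroOperator := by
  rintro ⟨x, hx⟩
  have hc : ∀ n : ℕ, Continuous fun y : HahnSpace logWeight => y.seq n :=
    fun n => (HahnSpace.coord logWeight n).continuous
  -- Along the orbit `y 0` is fixed and `y 0 - y 1` is halved, up to a common scalar. The resulting
  -- homogeneous inequality is closed, so density extends it to all `y`; the vector with `y 0 = 0`,
  -- `y 1 = 1` then forces `x 0 = 0`.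
  have key : ∀ y : HahnSpace logWeight,
      ‖y.seq 0 - y.seq 1‖ * ‖x.seq 0‖ ≤ ‖y.seq 0‖ * ‖x.seq 0 - x.seq 1‖ := by
    have hcl : IsClosed {y : HahnSpace logWeight |
        ‖y.seq 0 - y.seq 1‖ * ‖x.seq 0‖ ≤ ‖y.seq 0‖ * ‖x.seq 0 - x.seq 1‖} :=
      isClosed_le (((hc 0).sub (hc 1)).norm.mul continuous_const)
        ((hc 0).norm.mul continuous_const)
    refine fun y => hcl.closure_subset_iff.2 ?_ (hx y)
    rintro _ ⟨c, n, rfl⟩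
    simp only [Set.mem_ofPred_eq, HahnSpace.seq_smul, Pi.smul_apply, smul_eq_mul]
    rw [← mul_sub, cesaroOperator_pow_seq_zero_sub_one, cesaroOperator_pow_seq_zero]
    simp only [norm_mul, norm_pow]
    have h1 : ‖(1 / 2 : ℂ)‖ ^ n ≤ 1 := pow_le_one₀ (norm_nonneg _) (by norm_num)
    calc ‖c‖ * (‖(1 / 2 : ℂ)‖ ^ n * ‖x.seq 0 - x.seq 1‖) * ‖x.seq 0‖
        = ‖(1 / 2 : ℂ)‖ ^ n * (‖c‖ * ‖x.seq 0‖ * ‖x.seq 0 - x.seq 1‖) := by ring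
      _ ≤ _ := mul_le_of_le_one_left (by positivity) h1
  have h0 : x.seq 0 = 0 := by
    have := key (HahnSpace.basisVec logWeight 1)
    simpa using this
  have hz : ∀ y : HahnSpace logWeight, y.seq 0 = 0 := by
    have hcl : IsClosed {y : HahnSpace logWeight | y.seq 0 = 0} :=
      isClosed_eq (hc 0) continuous_const
    refine fun y => hcl.closure_subset_iff.2 ?_ (hx y)
    rintro _ ⟨c, n, rfl⟩
    rw [Set.mem_ofPred_eq, HahnSpace.seq_smul, Pi.smul_apply, cesaroOperator_pow_seq_zero, h0,
      smul_zero]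
  simpa using hz (HahnSpace.basisVec logWeight 0)

end CesaroSpectrum

theorem propositionP :
    ∃ C : HahnSpace logWeight →L[ℂ] HahnSpace logWeight,
      (∀ x : HahnSpace logWeight, (C x).seq = cesaroMean x.seq) ∧
      pointSpectrum C = ∅ ∧
      Metric.ball (1 / 2 : ℂ) (1 / 2) ∪ {1} ⊆ pointSpectrum (dualOperator C) ∧
      pointSpectrum (dualOperator C) ⊆ residualSpectrum C ∧
      Metric.closedBall (1 / 2 : ℂ) (1 / 2) ⊆ spectrum ℂ C ∧
      ¬ IsCompactOperator C ∧
      ¬ IsMeanErgodic C ∧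
      ¬ IsSupercyclic C :=
  ⟨cesaroOperator, cesaroOperator_seq,
    Set.eq_empty_of_forall_notMem fun z hz => hz (injective_smul_id_sub_cesaroOperator z),
    Set.union_subset ball_subset_pointSpectrum_dualOperator
      (Set.singleton_subset_iff.2 one_mem_pointSpectrum_dualOperator),
    fun z hz => ⟨injective_smul_id_sub_cesaroOperator z,
      not_denseRange_of_mem_pointSpectrum_dualOperator hz⟩,
    closedBall_subset_spectrum_cesaroOperator,
    not_isCompactOperator_cesaroOperator,
    not_isMeanErgodic_cesaroOperator,
    not_isSupercyclic_cesaroOperator⟩
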